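/- Let $k$ be an algebraically closed field of characteristic zero, and let $X\subseteq \mathbb{A}^m_k$ and $Y\subseteq\mathbb{A}^n_k$ be affine varieties, i.e. irreducible (in particular nonempty) Zariski closed subsets. Assume that $Y$ is factorial, i.e. that its coordinate ring $A(Y)=k[X_1,\dots,X_n]/I(Y)$ is a unique factorization domain. Let $\Phi\colon X\to Y$ be a regular map which is almost surjective, i.e. the Zariski closure in $Y$ of the complement of the image satisfies $$\dim\overline{Y\setminus\Phi(X)}\le \dim Y-2$$ (with $\dim\emptyset=-\infty$). Let $h\colon Y\to k$ be any function, not assumed regular, such that $h\circ\Phi$ is a regular function on $X$. Then there exists a regular function $p\colon Y\to k$ such that $p(y)=h(y)$ for all $y\in\Phi(X)$. -/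

import Mathlib

namespace AffineGeometry

/-- The set of points `k ^ n` of affine `n`-space over `k`, as a type of its own so that it can carry
the Zariski topology. -/
def AffSpace (k : Type*) (n : ℕ) : Type _ := Fin n → k

section

variable {k : Type*} [Field k]

/-- The common zero set in affine `n`-space of a set of polynomials. -/
def zeroSet {n : ℕ} (S : Set (MvPolynomial (Fin n) k)) : Set (AffSpace k n) :=
  {x | ∀ p ∈ S, MvPolynomial.eval x p = 0}

/-- The algebraic subsets of affine `n`-space. -/
def IsAlgebraicSet {n : ℕ} (V : Set (AffSpace k n)) : Prop :=
  ∃ S : Set (MvPolynomial (Fin n) k), V = zeroSet S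

theorem isAlgebraicSet_empty {n : ℕ} : IsAlgebraicSet (∅ : Set (AffSpace k n)) := by
  refine ⟨{1}, ?_⟩
  ext x
  simp [zeroSet]

theorem isAlgebraicSet_sInter {n : ℕ} (A : Set (Set (AffSpace k n)))
    (hA : ∀ V ∈ A, IsAlgebraicSet V) : IsAlgebraicSet (⋂₀ A) := by
  refine ⟨{p | ∃ V ∈ A, ∀ x ∈ V, MvPolynomial.eval x p = 0}, ?_⟩
  ext x
  constructor
  · rintro hx p ⟨V, hV, hp⟩
    exact hp x (hx V hV)
  · intro hx V hV
    obtain ⟨S, rfl⟩ := hA V hV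
    exact fun p hp => hx p ⟨_, hV, fun y hy => hy p hp⟩

theorem isAlgebraicSet_union {n : ℕ} (V W : Set (AffSpace k n)) (hV : IsAlgebraicSet V)
    (hW : IsAlgebraicSet W) : IsAlgebraicSet (V ∪ W) := by
  obtain ⟨S, rfl⟩ := hV
  obtain ⟨T, rfl⟩ := hW
  refine ⟨{r | ∃ p ∈ S, ∃ q ∈ T, r = p * q}, ?_⟩
  ext x
  constructor
  · rintro (hx | hx) r ⟨p, hp, q, hq, rfl⟩
    · rw [map_mul, hx p hp, zero_mul]
    · rw [map_mul, hx q hq, mul_zero]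
  · intro hx
    by_contra hcon
    rw [Set.mem_union, not_or] at hcon
    obtain ⟨h1, h2⟩ := hcon
    simp only [zeroSet, Set.mem_ofPred_eq, not_forall] at h1 h2
    obtain ⟨p, hp, hp0⟩ := h1
    obtain ⟨q, hq, hq0⟩ := h2
    have h := hx (p * q) ⟨p, hp, q, hq, rfl⟩
    rw [map_mul] at h
    exact (mul_ne_zero hp0 hq0) h

/-- The Zariski topology: the closed sets are the algebraic sets. Subsets carry the subspace
topology. -/
instance zariskiTopology (n : ℕ) : TopologicalSpace (AffSpace k n) :=
  TopologicalSpace.ofClosed {V | IsAlgebraicSet V} isAlgebraicSet_empty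
    (fun A hA => isAlgebraicSet_sInter A fun _ hV => hA hV)
    (fun V hV W hW => isAlgebraicSet_union V W hV hW)

/-- An affine variety in affine `n`-space: an irreducible (in particular nonempty) Zariski closed
subset. -/
def IsAffineVariety {n : ℕ} (V : Set (AffSpace k n)) : Prop :=
  IsClosed V ∧ IsIrreducible V

/-- The coordinate ring `A(V) = k[X₁, …, Xₙ] / I(V)`. -/
abbrev CoordinateRing {n : ℕ} (V : Set (AffSpace k n)) : Type _ :=
  MvPolynomial (Fin n) k ⧸ MvPolynomial.vanishingIdeal k (V : Set (Fin n → k))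

/-- `V` is factorial: its coordinate ring is a unique factorization domain. -/
def IsFactorial {n : ℕ} (V : Set (AffSpace k n)) : Prop :=
  IsDomain (CoordinateRing V) ∧ UniqueFactorizationMonoid (CoordinateRing V)

/-- Regular functions on an algebraic set: restrictions of polynomials, that is, the functions given
by the elements of the coordinate ring. -/
def IsRegularFunction {n : ℕ} {V : Set (AffSpace k n)} (f : V → k) : Prop :=
  ∃ p : MvPolynomial (Fin n) k, ∀ x : V, f x = MvPolynomial.eval (x : AffSpace k n) p

/-- Regular maps between algebraic sets: all coordinates are regular functions. -/
def IsRegularMap {m n : ℕ} {X : Set (AffSpace k m)} {Y : Set (AffSpace k n)} (Φ : X → Y) : Prop :=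
  ∀ i : Fin n, IsRegularFunction fun x : X => (Φ x : AffSpace k n) i

/-- `Φ` is almost surjective: the Zariski closure of the complement of its image has dimension at
most `dim Y - 2`. Dimensions are Krull dimensions in `WithBot ℕ∞`, and `⊥` is the dimension of the
empty set, so the condition is written without subtraction. -/
def IsAlmostSurjective {m n : ℕ} {X : Set (AffSpace k m)} {Y : Set (AffSpace k n)} (Φ : X → Y) :
    Prop :=
  topologicalKrullDim (closure ((Set.range Φ)ᶜ) : Set Y) + 2 ≤ topologicalKrullDim Y

end

end AffineGeometry

/-!
Let `A` and `B` be the coordinate rings of `Y` and `X`, and `f ∈ B` the regular function `h ∘ Φ`.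
As the image of `Φ` is dense, pullback embeds `A` into `B`.

First, `f` lies in the fraction field of `A`. Since `f` is constant on the fibres of `Φ`, the
element `f ⊗ 1 - 1 ⊗ f` vanishes at every rational point of `B ⊗[A] B`, hence is nilpotent by the
Nullstellensatz, and so is its image in `L ⊗[K] L`, where `K ⊆ L` are the fraction fields. If `f`
were not in `K`, there would be two `K`-algebra homomorphisms from `K[f]` to some field that
differ at `f` (this is where characteristic zero is used), and together they would send a nilpotent
element to a nonzero one.
This is `mem_range_algebraMap_of_isNilpotent_tmul_sub`.

Second, write `f = a / b` in lowest terms, which is possible as `A` is factorial, so that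
`b * f = a` holds on `X`. If `b` had a prime factor `q`, then `a` would vanish on the part of the
hypersurface `q = 0` lying in the image of `Φ`. That hypersurface is irreducible of codimension at
most one (`ringKrullDim_le_ringKrullDim_quotient_span_add_one`), so it is not contained in the
closure of the complement of the image, and `a` vanishes on all of it
(`IsRationalSpectrum.mem_of_forall_zeros_notMem`). Then `q` divides `a`, a contradiction. So `b`
is a unit and `a / b` is the regular function sought.

Varieties are handled through `IsRationalSpectrum`, which records that the points of a space are
the `k`-algebra homomorphisms from a given algebra to `k`, with the Zariski topology. In these
terms the Krull dimension of the space is that of the algebra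
(`IsRationalSpectrum.topologicalKrullDim_eq`).
-/

open scoped TensorProduct
open Topology TopologicalSpace

/-! ### Nilpotent elements of finitely generated algebras -/

/-- Over an algebraically closed field, an element of a finitely generated algebra that vanishes at
every rational point is nilpotent. -/
theorem isNilpotent_of_forall_algHom_eq_zero {k R : Type*} [Field k] [IsAlgClosed k] [CommRing R]
    [Algebra k R] [Algebra.FiniteType k R] {a : R} (ha : ∀ g : R →ₐ[k] k, g a = 0) :
    IsNilpotent a := by
  have : IsJacobsonRing R := isJacobsonRing_of_finiteType (A := k)
  rw [← mem_nilradical, nilradical, Ideal.radical_eq_jacobson, Ideal.jacobson, Ideal.mem_sInf]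
  rintro M ⟨-, hM⟩
  let : Field (R ⧸ M) := Ideal.Quotient.field M
  have : Module.Finite k (R ⧸ M) := finite_of_finite_type_of_isJacobsonRing k (R ⧸ M)
  let φ : (R ⧸ M) →ₐ[k] k := IsAlgClosed.lift
  have h := ha (φ.comp (Ideal.Quotient.mkₐ k M))
  rw [AlgHom.comp_apply, map_eq_zero] at h
  exact Ideal.Quotient.eq_zero_iff_mem.mp h

/-! ### Elements of the base field and nilpotents in the tensor square -/

/-- Two homomorphisms from a `K`-subalgebra of `L` to a field agree on `s` as soon as
`s ⊗ 1 - 1 ⊗ s` is nilpotent in `L ⊗ L`. -/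
theorem AlgHom.apply_eq_of_isNilpotent_tmul_sub {K L S Ω : Type*} [Field K] [CommRing L]
    [CommRing S] [Field Ω] [Algebra K L] [Algebra K S] [Algebra K Ω] {i : S →ₐ[K] L}
    (hi : Function.Injective i) (j₁ j₂ : S →ₐ[K] Ω) {s : S}
    (hs : IsNilpotent (i s ⊗ₜ[K] (1 : L) - (1 : L) ⊗ₜ[K] i s)) : j₁ s = j₂ s := by
  -- The tensor square of `S` embeds into that of `L` because everything is flat over a field.
  have hinj : Function.Injective (Algebra.TensorProduct.map i i) :=
    TensorProduct.map_injective_of_flat_flat i.toLinearMap i.toLinearMap hi hi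
  have hs' : IsNilpotent (s ⊗ₜ[K] (1 : S) - (1 : S) ⊗ₜ[K] s) := by
    rw [← IsNilpotent.map_iff hinj]
    simpa using hs
  have h := hs'.map (Algebra.TensorProduct.lift j₁ j₂ fun _ _ => .all _ _)
  simpa [sub_eq_zero] using h

/-- If `f ⊗ 1 - 1 ⊗ f` is nilpotent, then no other element of an extension field of `L` satisfies
all polynomial equations of `f` over `K`. -/
theorem eq_algebraMap_of_isNilpotent_tmul_sub {K L Ω : Type*} [Field K] [Field L] [Field Ω]
    [Algebra K L] [Algebra L Ω] [Algebra K Ω] [IsScalarTower K L Ω] {f : L} {y : Ω}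
    (hy : ∀ p : Polynomial K, Polynomial.aeval f p = 0 → Polynomial.aeval y p = 0)
    (hf : IsNilpotent (f ⊗ₜ[K] (1 : L) - (1 : L) ⊗ₜ[K] f)) : y = algebraMap L Ω f := by
  let i := Ideal.kerLiftAlg (Polynomial.aeval (R := K) f)
  let s := Ideal.Quotient.mk (RingHom.ker (Polynomial.aeval (R := K) f)) Polynomial.X
  have his : i s = f := (Ideal.kerLiftAlg_mk _ _).trans (Polynomial.aeval_X f)
  let j := Ideal.Quotient.liftₐ (RingHom.ker (Polynomial.aeval (R := K) f)) (Polynomial.aeval y)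
    fun p hp => hy p hp
  have hjs : j s = y := (Ideal.Quotient.lift_mk _ _ _).trans (Polynomial.aeval_X y)
  rw [← his] at hf
  have h := AlgHom.apply_eq_of_isNilpotent_tmul_sub (Ideal.kerLiftAlg_injective _) j
    ((IsScalarTower.toAlgHom K L Ω).comp i) hf
  rw [hjs, AlgHom.comp_apply, his] at h
  exact h

/-- In characteristic zero, `f ⊗ 1 - 1 ⊗ f` is nilpotent only for `f` in the base field: otherwise
two different homomorphisms from `K[f]` to an extension of `K` separate `f ⊗ 1` from `1 ⊗ f`. -/
theorem mem_range_algebraMap_of_isNilpotent_tmul_sub {K L : Type*} [Field K] [CharZero K] [Field L]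
    [Algebra K L] {f : L} (hf : IsNilpotent (f ⊗ₜ[K] (1 : L) - (1 : L) ⊗ₜ[K] f)) :
    f ∈ Set.range (algebraMap K L) := by
  by_cases halg : IsAlgebraic K f
  · by_contra hmem
    let Ω := AlgebraicClosure L
    have hint : IsIntegral K (algebraMap L Ω f) :=
      halg.isIntegral.map (IsScalarTower.toAlgHom K L Ω)
    have hmem' : algebraMap L Ω f ∉ (⊥ : Subalgebra K Ω) := by
      rw [Algebra.mem_bot]
      rintro ⟨c, hc⟩
      refine hmem ⟨c, (algebraMap L Ω).injective ?_⟩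
      rw [← hc, ← IsScalarTower.algebraMap_apply]
    obtain ⟨y, hne, hy⟩ := (notMem_iff_exists_ne_and_isConjRoot
      (minpoly.irreducible hint).separable (IsAlgClosed.splits _)).mp hmem'
    refine hne (eq_algebraMap_of_isNilpotent_tmul_sub (fun p hp => ?_) hf).symm
    rw [← minpoly.dvd_iff, ← hy, minpoly.dvd_iff, Polynomial.aeval_algebraMap_apply, hp, map_zero]
  · -- For transcendental `f` every element of `L` may serve as the image of `f`.
    have h : (0 : L) = algebraMap L L f := by
      refine eq_algebraMap_of_isNilpotent_tmul_sub (K := K) (fun p hp => ?_) hf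
      have : p = 0 := by_contra fun hp0 => halg ⟨p, hp0, hp⟩
      simp [this]
    exact ⟨0, by simpa using h⟩

/-! ### Functions constant on the fibres -/

/-- The same for a homomorphism `A → B` whose target maps to an extension of a field under `A`. -/
theorem algebraMap_mem_range_of_isNilpotent_tmul_sub {A B K L : Type*}
    [CommRing A] [CommRing B] [Algebra A B] [Field K] [CharZero K] [Field L] [Algebra A K]
    [Algebra B L] [Algebra K L] [Algebra A L] [IsScalarTower A K L] [IsScalarTower A B L]
    {f : B} (hf : IsNilpotent (f ⊗ₜ[A] (1 : B) - (1 : B) ⊗ₜ[A] f)) :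
    algebraMap B L f ∈ Set.range (algebraMap K L) := by
  refine mem_range_algebraMap_of_isNilpotent_tmul_sub ?_
  let toL : B →ₐ[A] L := IsScalarTower.toAlgHom A B L
  let t : B ⊗[A] B →ₐ[A] L ⊗[K] L := Algebra.TensorProduct.lift
    ((Algebra.TensorProduct.includeLeft (R := K) (S := A)).comp toL)
    (((Algebra.TensorProduct.includeRight (R := K)).restrictScalars A).comp toL) fun _ _ => .all _ _
  simpa [t, toL] using hf.map t

/-- If a function on `Spec B` is constant on the rational fibres of `Spec B → Spec A`, then it lies
in the fraction field of `A`, in characteristic zero. -/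
theorem exists_algebraMap_mul_eq_of_constant_on_fibers {k A B : Type*} [Field k] [IsAlgClosed k]
    [CharZero k] [CommRing A] [IsDomain A] [UniqueFactorizationMonoid A] [CommRing B] [IsDomain B]
    [Algebra k A] [Algebra k B]
    [Algebra A B] [IsScalarTower k A B] [FaithfulSMul A B] [Algebra.FiniteType k B] {f : B}
    (hf : ∀ g₁ g₂ : B →ₐ[k] k, (∀ a : A, g₁ (algebraMap A B a) = g₂ (algebraMap A B a)) →
      g₁ f = g₂ f) :
    ∃ a b : A, b ≠ 0 ∧ IsRelPrime a b ∧ algebraMap A B b * f = algebraMap A B a := by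
  have : Algebra.FiniteType A B := Algebra.FiniteType.of_restrictScalars_finiteType k A B
  have : Algebra.FiniteType k (B ⊗[A] B) :=
    Algebra.FiniteType.trans (S := B) inferInstance inferInstance
  -- The rational points of the fibre product of `Spec B` with itself are pairs of points
  -- of `Spec B` in the same fibre.
  have hnil : IsNilpotent (f ⊗ₜ[A] (1 : B) - (1 : B) ⊗ₜ[A] f) := by
    refine isNilpotent_of_forall_algHom_eq_zero (k := k) fun g => ?_
    rw [map_sub, sub_eq_zero]
    refine hf (g.comp (Algebra.TensorProduct.includeLeft (S := k)))
      (g.comp (Algebra.TensorProduct.includeRight.restrictScalars k)) fun a => ?_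
    simp [Algebra.TensorProduct.algebraMap_apply]
  let K := FractionRing A
  let L := FractionRing B
  let : Algebra K L := FractionRing.liftAlgebra A L
  have : CharZero A := charZero_of_injective_algebraMap (algebraMap k A).injective
  have : CharZero K := charZero_of_injective_algebraMap (IsFractionRing.injective A K)
  obtain ⟨c, hc⟩ := algebraMap_mem_range_of_isNilpotent_tmul_sub (K := K) (L := L)
    hnil
  obtain ⟨a, b, hab, rfl⟩ := IsFractionRing.exists_reduced_fraction (A := A) c
  refine ⟨a, b, nonZeroDivisors.ne_zero b.2, hab, IsFractionRing.injective B L ?_⟩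
  rw [map_mul, ← hc, ← IsScalarTower.algebraMap_apply, ← IsScalarTower.algebraMap_apply,
    IsScalarTower.algebraMap_apply A K L, IsScalarTower.algebraMap_apply A K L, ← map_mul,
    IsLocalization.mk'_spec']

/-! ### Dimension of hypersurfaces -/

theorem MvPolynomial.height_eq_of_isMaximal {k : Type*} [Field k] (s : ℕ)
    (M : Ideal (MvPolynomial (Fin s) k)) [M.IsMaximal] : M.height = s := by
  induction s with
  | zero =>
    have h : M.height ≤ ringKrullDim (MvPolynomial (Fin 0) k) :=
      Ideal.height_le_ringKrullDim_of_ne_top Ideal.IsPrime.ne_top'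
    simpa using h
  | succ s ih =>
    let e := (MvPolynomial.finSuccEquiv k s).toRingEquiv.symm
    obtain ⟨P, hP⟩ : ∃ P : Ideal (Polynomial (MvPolynomial (Fin s) k)), P = M.comap e := ⟨_, rfl⟩
    have : P.IsMaximal := hP ▸ Ideal.comap_isMaximal_of_equiv e
    have : (P.comap (Polynomial.C : MvPolynomial (Fin s) k →+* _)).IsMaximal :=
      Polynomial.isMaximal_comap_C_of_isJacobsonRing P
    have : P.LiesOver (P.comap (Polynomial.C : MvPolynomial (Fin s) k →+* _)) := ⟨rfl⟩
    rw [← e.height_comap M, ← hP, Polynomial.height_eq_height_add_one (P.comap Polynomial.C) P, ih]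
    simp

theorem ringKrullDim_le_of_isIntegral (R S : Type*) [CommRing R] [CommRing S] [Algebra R S]
    [Algebra.IsIntegral R S] : ringKrullDim S ≤ ringKrullDim R :=
  Order.krullDim_le_of_strictMono (PrimeSpectrum.comap (algebraMap R S)) fun _ _ h =>
    Ideal.IsIntegral.comap_lt_comap h

/-- The quotient of an affine domain by a principal proper ideal loses at most one dimension. By
Noether normalization and going down, every maximal ideal of the domain has full height. -/
theorem ringKrullDim_le_ringKrullDim_quotient_span_add_one (k : Type*) {A : Type*} [Field k]
    [CommRing A] [IsDomain A] [Algebra k A] [Algebra.FiniteType k A] {q : A} (hq : ¬ IsUnit q) :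
    ringKrullDim A ≤ ringKrullDim (A ⧸ Ideal.span {q}) + 1 := by
  obtain ⟨s, g, hg, hint⟩ := exists_integral_inj_algHom_of_fg k A
  let R := MvPolynomial (Fin s) k
  let := g.toRingHom.toAlgebra
  have : Algebra.IsIntegral R A := ⟨hint⟩
  have : FaithfulSMul R A := (faithfulSMul_iff_algebraMap_injective R A).mpr hg
  have : IsNoetherianRing A := Algebra.FiniteType.isNoetherianRing k A
  obtain ⟨M, hM, hqM⟩ := exists_max_ideal_of_mem_nonunits hq
  have : (M.under R).IsMaximal := inferInstance
  have hle : (s : ℕ∞) ≤ M.height := by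
    rw [Ideal.height_eq_height_add_of_liesOver_of_hasGoingDown (M.under R) M,
      MvPolynomial.height_eq_of_isMaximal s (M.under R)]
    exact le_self_add
  calc ringKrullDim A ≤ ringKrullDim R := ringKrullDim_le_of_isIntegral R A
    _ = ((s : ℕ∞) : WithBot ℕ∞) := by simp [R]
    _ ≤ M.height := by exact_mod_cast hle
    _ ≤ _ := Ideal.height_le_ringKrullDim_quotient_add_one hqM

theorem ringKrullDim_lt_top_of_finiteType (k A : Type*) [Field k] [CommRing A] [Algebra k A]
    [Algebra.FiniteType k A] : ringKrullDim A < ⊤ := by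
  obtain ⟨n, g, hg⟩ := Algebra.FiniteType.iff_quotient_mvPolynomial''.mp ‹Algebra.FiniteType k A›
  refine (ringKrullDim_le_of_surjective g.toRingHom hg).trans_lt ?_
  simp only [MvPolynomial.ringKrullDim_of_isNoetherianRing, ringKrullDim_eq_zero_of_field, zero_add]
  exact WithBot.coe_lt_coe.mpr (ENat.natCast_lt_top _)

/-! ### Rational points of an affine algebra and their topology -/

/-- `ev` presents the topological space `T` as the set of `k`-rational points of the spectrum of `A`
with its Zariski topology: the points are the `k`-algebra homomorphisms `A → k`, and the closed sets
are the common zero sets of elements of `A`. -/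
structure IsRationalSpectrum {k A T : Type*} [Field k] [CommRing A] [Algebra k A]
    [TopologicalSpace T] (ev : T → A →ₐ[k] k) : Prop where
  bijective : Function.Bijective ev
  isClosed_iff : ∀ C : Set T, IsClosed C ↔ ∃ S : Set A, C = {t | ∀ a ∈ S, ev t a = 0}

namespace IsRationalSpectrum

variable {k A B T : Type*} [Field k] [CommRing A] [Algebra k A] [CommRing B] [Algebra k B]
  [TopologicalSpace T] {ev : T → A →ₐ[k] k}

theorem isClosed_zeros (h : IsRationalSpectrum ev) (S : Set A) :
    IsClosed {t | ∀ a ∈ S, ev t a = 0} :=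
  (h.isClosed_iff _).mpr ⟨S, rfl⟩

theorem isClosed_zeros_singleton (h : IsRationalSpectrum ev) (a : A) : IsClosed {t | ev t a = 0} :=
  (h.isClosed_iff _).mpr ⟨{a}, by simp⟩

/-- A closed subspace is the rational spectrum of a quotient. -/
theorem subtype (h : IsRationalSpectrum ev) {π : A →ₐ[k] B} (hπ : Function.Surjective π)
    {V : Set T} (hV : ∀ t, t ∈ V ↔ ∀ a, π a = 0 → ev t a = 0) {ev' : V → B →ₐ[k] k}
    (hev : ∀ v a, ev' v (π a) = ev v a) : IsRationalSpectrum ev' where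
  bijective := by
    refine ⟨fun v w hvw => Subtype.ext (h.bijective.1 ?_), fun g => ?_⟩
    · ext a
      rw [← hev, ← hev, hvw]
    · obtain ⟨t, ht⟩ := h.bijective.2 (g.comp π)
      have htV : t ∈ V := (hV t).mpr fun a ha => by simp [ht, ha]
      refine ⟨⟨t, htV⟩, ?_⟩
      ext b
      obtain ⟨a, rfl⟩ := hπ b
      simp [hev, ht]
  isClosed_iff C := by
    rw [isClosed_induced_iff]
    constructor
    · rintro ⟨D, hD, rfl⟩
      obtain ⟨S, rfl⟩ := (h.isClosed_iff D).mp hD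
      exact ⟨π '' S, by ext v; simp [hev]⟩
    · rintro ⟨S, rfl⟩
      refine ⟨_, h.isClosed_zeros (π ⁻¹' S), ?_⟩
      ext v
      simp [← hev, hπ.forall]

/-- The Nullstellensatz for prime ideals. -/
theorem mem_of_forall_zeros [IsAlgClosed k] [Algebra.FiniteType k A] (h : IsRationalSpectrum ev)
    {P : Ideal A} [P.IsPrime] {a : A}
    (ha : ∀ t, (∀ p ∈ P, ev t p = 0) → ev t a = 0) : a ∈ P := by
  have hnil : IsNilpotent (Ideal.Quotient.mkₐ k P a) := by
    refine isNilpotent_of_forall_algHom_eq_zero (k := k) fun g => ?_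
    obtain ⟨t, ht⟩ := h.bijective.2 (g.comp (Ideal.Quotient.mkₐ k P))
    rw [← AlgHom.comp_apply, ← ht]
    refine ha t fun p hp => ?_
    rw [ht, AlgHom.comp_apply, Ideal.Quotient.mkₐ_eq_mk, Ideal.Quotient.eq_zero_iff_mem.mpr hp,
      map_zero]
  exact Ideal.Quotient.eq_zero_iff_mem.mp hnil.eq_zero

theorem isIrreducible_zeros [IsAlgClosed k] [Algebra.FiniteType k A] (h : IsRationalSpectrum ev)
    (P : Ideal A) [hP : P.IsPrime] : IsIrreducible {t | ∀ p ∈ P, ev t p = 0} := by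
  constructor
  · by_contra hemp
    rw [Set.not_nonempty_iff_eq_empty] at hemp
    refine hP.ne_top ((Ideal.eq_top_iff_one P).mpr (h.mem_of_forall_zeros fun t ht => ?_))
    exact absurd (hemp ▸ ht : t ∈ (∅ : Set T)) (Set.notMem_empty t)
  · rw [isPreirreducible_iff_isClosed_union_isClosed]
    intro C D hC hD hCD
    obtain ⟨S, rfl⟩ := (h.isClosed_iff C).mp hC
    obtain ⟨S', rfl⟩ := (h.isClosed_iff D).mp hD
    by_contra! hnot
    obtain ⟨hn, hn'⟩ := hnot
    rw [Set.not_subset] at hn hn'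
    obtain ⟨t, htP, ht⟩ := hn
    obtain ⟨t', htP', ht'⟩ := hn'
    simp only [Set.mem_ofPred_eq, not_forall] at ht ht'
    obtain ⟨a, ha, hta⟩ := ht
    obtain ⟨a', ha', hta'⟩ := ht'
    have hmem : a * a' ∈ P := h.mem_of_forall_zeros fun s hs => by
      rcases hCD hs with hs | hs
      · simp [hs a ha]
      · simp [hs a' ha']
    rcases hP.mem_or_mem hmem with hm | hm
    · exact hta (htP _ hm)
    · exact hta' (htP' _ hm)

theorem isPrime_vanishing (h : IsRationalSpectrum ev) {C : Set T} (hC : IsIrreducible C) :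
    (⨅ t ∈ C, RingHom.ker (ev t)).IsPrime := by
  constructor
  · obtain ⟨t, ht⟩ := hC.1
    rw [Ideal.ne_top_iff_one]
    simp only [Submodule.mem_iInf, not_forall]
    exact ⟨t, ht, by simp⟩
  · intro a b hab
    have hsub : C ⊆ {t | ev t a = 0} ∪ {t | ev t b = 0} := fun t ht => by
      simp only [Submodule.mem_iInf, RingHom.mem_ker, map_mul] at hab
      exact mul_eq_zero.mp (hab t ht)
    simp only [Submodule.mem_iInf, RingHom.mem_ker]
    exact (isPreirreducible_iff_isClosed_union_isClosed.mp hC.2 _ _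
      (h.isClosed_zeros_singleton a) (h.isClosed_zeros_singleton b) hsub).imp
        (fun hs t ht => hs ht) (fun hs t ht => hs ht)

theorem topologicalKrullDim_le_ringKrullDim (h : IsRationalSpectrum ev) :
    topologicalKrullDim T ≤ ringKrullDim A := by
  rw [ringKrullDim, ← Order.krullDim_orderDual]
  refine Order.krullDim_le_of_strictMono
    (fun C : IrreducibleCloseds T => OrderDual.toDual
      (⟨_, h.isPrime_vanishing C.isIrreducible⟩ : PrimeSpectrum A)) fun C D hCD => ?_
  have hle : (⨅ t ∈ D, RingHom.ker (ev t)) ≤ ⨅ t ∈ C, RingHom.ker (ev t) :=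
    biInf_mono fun t ht => hCD.le ht
  refine lt_of_le_of_ne hle fun heq => hCD.not_ge fun t ht => ?_
  have hI : (⨅ t ∈ C, RingHom.ker (ev t)) = ⨅ t ∈ D, RingHom.ker (ev t) :=
    congrArg (fun x => (OrderDual.ofDual x).asIdeal) heq
  obtain ⟨S, hS⟩ := (h.isClosed_iff _).mp C.isClosed
  have hmem : t ∈ (C : Set T) := by
    rw [hS]
    intro a ha
    have haC : a ∈ ⨅ t ∈ C, RingHom.ker (ev t) := by
      simp only [Submodule.mem_iInf, RingHom.mem_ker]
      intro s hs
      have hs' : s ∈ (C : Set T) := hs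
      rw [hS] at hs'
      exact hs' a ha
    rw [hI] at haC
    simp only [Submodule.mem_iInf, RingHom.mem_ker] at haC
    exact haC t ht
  exact hmem

theorem ringKrullDim_le_topologicalKrullDim [IsAlgClosed k] [Algebra.FiniteType k A]
    (h : IsRationalSpectrum ev) : ringKrullDim A ≤ topologicalKrullDim T := by
  rw [topologicalKrullDim, ← Order.krullDim_orderDual (α := IrreducibleCloseds T)]
  refine Order.krullDim_le_of_strictMono
    (fun P : PrimeSpectrum A => OrderDual.toDual
      (⟨_, h.isIrreducible_zeros P.asIdeal, h.isClosed_zeros P.asIdeal⟩ : IrreducibleCloseds T))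
    fun P Q hPQ => ?_
  have hle : {t | ∀ p ∈ Q.asIdeal, ev t p = 0} ⊆ {t | ∀ p ∈ P.asIdeal, ev t p = 0} :=
    fun t ht p hp => ht p (hPQ.le hp)
  refine lt_of_le_of_ne hle fun heq => hPQ.not_ge fun a ha => ?_
  have hZ : {t | ∀ p ∈ P.asIdeal, ev t p = 0} = {t | ∀ p ∈ Q.asIdeal, ev t p = 0} :=
    congrArg (fun x => ((OrderDual.ofDual x : IrreducibleCloseds T) : Set T)) heq
  refine h.mem_of_forall_zeros fun t ht => ?_
  exact (hZ ▸ ht : t ∈ {t | ∀ p ∈ Q.asIdeal, ev t p = 0}) a ha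

theorem topologicalKrullDim_eq [IsAlgClosed k] [Algebra.FiniteType k A]
    (h : IsRationalSpectrum ev) : topologicalKrullDim T = ringKrullDim A :=
  h.topologicalKrullDim_le_ringKrullDim.antisymm h.ringKrullDim_le_topologicalKrullDim

/-- A subset of codimension at least two contains no zero locus of a prime ideal of codimension at
most one, so a function vanishing on the rest of that locus lies in the prime ideal. -/
theorem mem_of_forall_zeros_notMem [IsAlgClosed k] [Algebra.FiniteType k A]
    (h : IsRationalSpectrum ev) {Z : Set T} (hZ : IsClosed Z)
    (hdim : topologicalKrullDim Z + 2 ≤ topologicalKrullDim T) {P : Ideal A} [hP : P.IsPrime]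
    (hPdim : ringKrullDim A ≤ ringKrullDim (A ⧸ P) + 1) {a : A}
    (ha : ∀ t ∉ Z, (∀ p ∈ P, ev t p = 0) → ev t a = 0) : a ∈ P := by
  have hsub : {t | ∀ p ∈ P, ev t p = 0} ⊆ Z ∪ {t | ev t a = 0} := fun t ht =>
    or_iff_not_imp_left.mpr fun htZ => ha t htZ ht
  rcases isPreirreducible_iff_isClosed_union_isClosed.mp (h.isIrreducible_zeros P).2 _ _ hZ
    (h.isClosed_zeros_singleton a) hsub with hs | hs
  · exfalso
    have hV : IsRationalSpectrum (k := k) (A := A ⧸ P) (T := {t | ∀ p ∈ P, ev t p = 0})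
        fun t => Ideal.Quotient.liftₐ P (ev t) t.2 :=
      h.subtype (Ideal.Quotient.mkₐ_surjective k P)
        (fun t => by simp [Ideal.Quotient.eq_zero_iff_mem]) fun _ _ => rfl
    have hVZ : ringKrullDim (A ⧸ P) ≤ topologicalKrullDim Z :=
      hV.topologicalKrullDim_eq.symm.trans_le
        (IsEmbedding.inclusion hs).isInducing.topologicalKrullDim_le
    have hlt : ringKrullDim (A ⧸ P) < ⊤ := ringKrullDim_lt_top_of_finiteType k _
    have hnonneg : 0 ≤ ringKrullDim (A ⧸ P) := ringKrullDim_nonneg_of_nontrivial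
    rw [h.topologicalKrullDim_eq] at hdim
    have hcontra : ringKrullDim (A ⧸ P) + 2 ≤ ringKrullDim (A ⧸ P) + 1 :=
      (add_le_add_left hVZ 2).trans (hdim.trans hPdim)
    generalize ringKrullDim (A ⧸ P) = d at hlt hnonneg hcontra
    induction d with
    | bot => simp at hnonneg
    | coe d =>
      lift d to ℕ using (WithBot.coe_lt_coe.mp hlt).ne
      have hle : ((d + 2 : ℕ) : WithBot ℕ∞) ≤ ((d + 1 : ℕ) : WithBot ℕ∞) := by
        push_cast
        exact hcontra
      have := Nat.cast_le.mp hle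
      omega
  · exact h.mem_of_forall_zeros fun t ht => hs ht

end IsRationalSpectrum

/-! ### Descent of regular functions along almost surjective maps -/

/-- The descent statement for rational spectra: a function on the source that is constant on fibres
is the pullback of a regular function on a factorial target, if the image misses only a subset of
codimension at least two. -/
theorem exists_eq_comp_of_almostSurjective {k A B X Y : Type*} [Field k] [IsAlgClosed k]
    [CharZero k] [CommRing A] [IsDomain A] [UniqueFactorizationMonoid A] [Algebra k A]
    [Algebra.FiniteType k A]
    [CommRing B] [IsDomain B] [Algebra k B] [Algebra.FiniteType k B]
    [TopologicalSpace X] [TopologicalSpace Y] {evX : X → B →ₐ[k] k} {evY : Y → A →ₐ[k] k}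
    (hX : IsRationalSpectrum evX) (hY : IsRationalSpectrum evY) {Φ : X → Y} {φ : A →ₐ[k] B}
    (hΦ : ∀ x a, evX x (φ a) = evY (Φ x) a)
    (hsurj : topologicalKrullDim (closure (Set.range Φ)ᶜ : Set Y) + 2 ≤ topologicalKrullDim Y)
    {h : Y → k} {f : B} (hf : ∀ x, h (Φ x) = evX x f) : ∃ p : A, ∀ x, evY (Φ x) p = h (Φ x) := by
  have hrange : ∀ y ∉ closure (Set.range Φ)ᶜ, ∃ x, Φ x = y := fun y hy => by
    by_contra hne
    exact hy (subset_closure hne)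
  -- The image is dense, so pullback of functions is injective.
  have hinj : Function.Injective φ := by
    refine (injective_iff_map_eq_zero φ).mpr fun a ha => ?_
    have hbot : ringKrullDim A ≤ ringKrullDim (A ⧸ (⊥ : Ideal A)) + 1 := by
      rw [ringKrullDim_eq_of_ringEquiv (RingEquiv.quotientBot A)]
      exact le_add_of_nonneg_right zero_le_one
    refine hY.mem_of_forall_zeros_notMem isClosed_closure hsurj hbot fun y hy _ => ?_
    obtain ⟨x, rfl⟩ := hrange y hy
    rw [← hΦ, ha, map_zero]
  let := φ.toRingHom.toAlgebra
  have : IsScalarTower k A B := .of_algebraMap_eq fun c => (φ.commutes c).symm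
  have : FaithfulSMul A B := (faithfulSMul_iff_algebraMap_injective A B).mpr hinj
  obtain ⟨a, b, hb0, hab, hbf⟩ := exists_algebraMap_mul_eq_of_constant_on_fibers (k := k) (A := A)
    (f := f) fun g₁ g₂ hg => by
      obtain ⟨x₁, rfl⟩ := hX.bijective.2 g₁
      obtain ⟨x₂, rfl⟩ := hX.bijective.2 g₂
      have hx : Φ x₁ = Φ x₂ := hY.bijective.1 <| AlgHom.ext fun a => by
        rw [← hΦ, ← hΦ]
        exact hg a
      rw [← hf, ← hf, hx]
  have hpt : ∀ x, evY (Φ x) b * h (Φ x) = evY (Φ x) a := fun x => by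
    rw [hf, ← hΦ, ← hΦ, ← map_mul]
    exact congrArg (evX x) hbf
  -- A prime factor of the denominator would divide the numerator as well.
  have hunit : IsUnit b := by
    by_contra hb
    obtain ⟨q, hq, hqb⟩ := WfDvdMonoid.exists_irreducible_factor hb hb0
    have : (Ideal.span {q}).IsPrime :=
      (Ideal.span_singleton_prime hq.ne_zero).mpr hq.prime
    refine hq.not_isUnit (hab (Ideal.mem_span_singleton.mp ?_) hqb)
    refine hY.mem_of_forall_zeros_notMem isClosed_closure hsurj
      (ringKrullDim_le_ringKrullDim_quotient_span_add_one k hq.not_isUnit) fun y hy hzero => ?_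
    obtain ⟨x, rfl⟩ := hrange y hy
    have hby : evY (Φ x) b = 0 := hzero b (Ideal.mem_span_singleton.mpr hqb)
    rw [← hpt, hby, zero_mul]
  obtain ⟨u, rfl⟩ := hunit
  refine ⟨a * ↑u⁻¹, fun x => ?_⟩
  have hu : evY (Φ x) ↑u * evY (Φ x) ↑u⁻¹ = 1 := by rw [← map_mul, Units.mul_inv, map_one]
  rw [map_mul, ← hpt]
  linear_combination h (Φ x) * hu

/-! ### Affine varieties as rational spectra -/

namespace AffineGeometry

variable {k : Type*} [Field k] {n : ℕ}

theorem isRationalSpectrum_affSpace :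
    IsRationalSpectrum fun x : AffSpace k n =>
      (MvPolynomial.aeval x : MvPolynomial (Fin n) k →ₐ[k] k)
    where
  bijective := by
    refine ⟨fun x y hxy => ?_, fun g => ⟨fun i => g (MvPolynomial.X i), ?_⟩⟩
    · funext i
      exact (MvPolynomial.aeval_X (R := k) x i).symm.trans
        ((DFunLike.congr_fun hxy (MvPolynomial.X i)).trans (MvPolynomial.aeval_X y i))
    · ext i
      simp
  isClosed_iff C := by
    rw [← isOpen_compl_iff]
    change Cᶜᶜ ∈ _ ↔ _
    rw [compl_compl]
    rfl

/-- Evaluation of elements of the coordinate ring at a point of the algebraic set. -/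
noncomputable def evalAt (V : Set (AffSpace k n)) (v : V) : CoordinateRing V →ₐ[k] k :=
  Ideal.Quotient.liftₐ (MvPolynomial.vanishingIdeal k (V : Set (Fin n → k)))
    (MvPolynomial.aeval (v : AffSpace k n)) fun _ hp => hp _ v.2

theorem isRationalSpectrum_evalAt {V : Set (AffSpace k n)} (hV : IsClosed V) :
    IsRationalSpectrum (evalAt V) := by
  refine isRationalSpectrum_affSpace.subtype (Ideal.Quotient.mkₐ_surjective k _) (fun x => ?_)
    fun _ _ => rfl
  simp only [Ideal.Quotient.mkₐ_eq_mk, Ideal.Quotient.eq_zero_iff_mem]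
  refine ⟨fun hx p hp => hp x hx, fun hx => ?_⟩
  obtain ⟨S, rfl⟩ := (isRationalSpectrum_affSpace.isClosed_iff V).mp hV
  exact fun p hp => hx p fun y hy => hy p hp

theorem eq_zero_of_forall_evalAt_eq_zero {V : Set (AffSpace k n)} {a : CoordinateRing V}
    (ha : ∀ v, evalAt V v a = 0) : a = 0 := by
  obtain ⟨p, rfl⟩ := Ideal.Quotient.mk_surjective a
  exact Ideal.Quotient.eq_zero_iff_mem.mpr fun x hx => ha ⟨x, hx⟩

theorem isDomain_coordinateRing {V : Set (AffSpace k n)} (hV : IsAffineVariety V) :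
    IsDomain (CoordinateRing V) := by
  have hirr : IsIrreducible (Set.univ : Set V) :=
    (irreducibleSpace_def V).mp (isIrreducible_iff_irreducibleSpace.mp hV.2)
  have hprime := (isRationalSpectrum_evalAt hV.1).isPrime_vanishing hirr
  have hbot : (⨅ v ∈ (Set.univ : Set V), RingHom.ker (evalAt V v)) = ⊥ := by
    refine eq_bot_iff.mpr fun a ha => ?_
    simp only [Submodule.mem_iInf, RingHom.mem_ker] at ha
    exact eq_zero_of_forall_evalAt_eq_zero fun v => ha v trivial
  rw [hbot] at hprime
  exact IsDomain.of_bot_isPrime _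

theorem isRegularFunction_iff {V : Set (AffSpace k n)} {f : V → k} :
    IsRegularFunction f ↔ ∃ a : CoordinateRing V, ∀ v, f v = evalAt V v a :=
  ⟨fun ⟨p, hp⟩ => ⟨Ideal.Quotient.mk _ p, hp⟩, fun ⟨a, ha⟩ => by
    obtain ⟨p, rfl⟩ := Ideal.Quotient.mk_surjective a
    exact ⟨p, ha⟩⟩

/-- A regular map induces a homomorphism of coordinate rings. -/
theorem IsRegularMap.exists_algHom {m : ℕ} {X : Set (AffSpace k m)} {Y : Set (AffSpace k n)}
    {Φ : X → Y} (hΦ : IsRegularMap Φ) :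
    ∃ φ : CoordinateRing Y →ₐ[k] CoordinateRing X, ∀ x a, evalAt X x (φ a) = evalAt Y (Φ x) a := by
  choose c hc using fun i => isRegularFunction_iff.mp (hΦ i)
  have hcomp : ∀ x p, evalAt X x (MvPolynomial.aeval c p) =
      MvPolynomial.eval (Φ x : AffSpace k n) p := fun x p => by
    have hx : (fun i => evalAt X x (c i)) = (Φ x : AffSpace k n) := funext fun i => (hc i x).symm
    rw [← hx, ← AlgHom.comp_apply, MvPolynomial.comp_aeval]
    rfl
  refine ⟨Ideal.Quotient.liftₐ _ (MvPolynomial.aeval c) fun p hp =>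
    eq_zero_of_forall_evalAt_eq_zero fun x => ?_, fun x a => ?_⟩
  · rw [hcomp]
    exact hp _ (Φ x).2
  · obtain ⟨p, rfl⟩ := Ideal.Quotient.mk_surjective a
    exact hcomp x p

end AffineGeometry

theorem mainTheorem2 {k : Type*} [Field k] [IsAlgClosed k] [CharZero k] {m n : ℕ}
    (X : Set (AffineGeometry.AffSpace k m)) (Y : Set (AffineGeometry.AffSpace k n))
    (hX : AffineGeometry.IsAffineVariety X) (hY : AffineGeometry.IsAffineVariety Y)
    (hfact : AffineGeometry.IsFactorial Y)
    (Φ : X → Y) (hΦ : AffineGeometry.IsRegularMap Φ) (hsurj : AffineGeometry.IsAlmostSurjective Φ)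
    (h : Y → k) (hreg : AffineGeometry.IsRegularFunction (h ∘ Φ)) :
    ∃ p : Y → k, AffineGeometry.IsRegularFunction p ∧ ∀ y ∈ Set.range Φ, p y = h y := by
  obtain ⟨_, _⟩ := hfact
  have := AffineGeometry.isDomain_coordinateRing hX
  obtain ⟨φ, hφ⟩ := hΦ.exists_algHom
  obtain ⟨f, hf⟩ := AffineGeometry.isRegularFunction_iff.mp hreg
  obtain ⟨p, hp⟩ := exists_eq_comp_of_almostSurjective
    (AffineGeometry.isRationalSpectrum_evalAt hX.1) (AffineGeometry.isRationalSpectrum_evalAt hY.1)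
    hφ hsurj hf
  refine ⟨fun y => AffineGeometry.evalAt Y y p,
    AffineGeometry.isRegularFunction_iff.mpr ⟨p, fun _ => rfl⟩, ?_⟩
  rintro _ ⟨x, rfl⟩
  exact hp x
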